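/- Let $\mu\subseteq\lambda$ be partitions, let $\lambda/\mu$ be the skew diagram consisting of the boxes of the diagram of $\lambda$ that are not in the diagram of $\mu$ (it need not be connected), and let $m$ be the number of boxes in a longest column of $\lambda/\mu$ (with $m=0$ if $\lambda=\mu$). Let $s_{\lambda/\mu}=\sum_T x^T$ be the skew Schur function in the variables $x_1,x_2,\ldots$, where $T$ runs over all semistandard skew tableaux of shape $\lambda/\mu$ (fillings with positive integers that weakly increase along rows and strictly increase down columns) and $x^T=\prod_i x_i^{t_i}$ with $t_i$ the number of entries of $T$ equal to $i$; for a partition $\nu$ let $s_\nu=s_{\nu/\emptyset}$. Let $n$ be a nonnegative integer. An identity between such functions is said to hold in $\Lambda$ if it holds as an identity of formal power series in $x_1,x_2,\ldots$, and to hold in $\Lambda_n$ if it holds after setting $x_i=0$ for all $i>n$. 1. If $m>n$, then $s_{\lambda/\mu}=0$ in $\Lambda_n$. 2. If $m<n$, then for every partition $\nu$, $s_{\lambda/\mu}=s_\nu$ in $\Lambda_n$ if and only if $s_{\lambda/\mu}=s_\nu$ in $\Lambda$. -/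

import Mathlib

/-- The boxes of the skew diagram `lam / mu`: those of `lam` that are not in `mu`.
A box is a pair (row, column), numbered from `0` as in Mathlib. -/
def skewCells (lam mu : YoungDiagram) : Finset (ℕ × ℕ) :=
  lam.cells \ mu.cells

/-- The length of (number of boxes in) column `j` of `lam / mu`. -/
def skewColLen (lam mu : YoungDiagram) (j : ℕ) : ℕ :=
  ((skewCells lam mu).filter (fun c => c.2 = j)).card

/-- The length of the longest column of `lam / mu`; it is `0` if there are no boxes. -/
def longestColumn (lam mu : YoungDiagram) : ℕ :=
  (skewCells lam mu).sup (fun c => skewColLen lam mu c.2)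

/-- Semistandard skew tableaux of shape `lam / mu`. As for Mathlib's `SemistandardYoungTableau`,
the alphabet is `{0, 1, 2, …}` (the letter `k` stands for the positive integer `k + 1`), and
`entry` vanishes outside the shape, so that a tableau is determined by its entries in the boxes. -/
@[ext]
structure SkewTableau (lam mu : YoungDiagram) where
  /-- `entry i j` is the entry of the box in row `i` and column `j`. -/
  entry : ℕ → ℕ → ℕ
  /-- The entries in each row weakly increase from left to right. -/
  row_weak : ∀ i j1 j2 : ℕ, j1 < j2 → (i, j1) ∈ skewCells lam mu → (i, j2) ∈ skewCells lam mu →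
    entry i j1 ≤ entry i j2
  /-- The entries in each column strictly increase from top to bottom. -/
  col_strict : ∀ i1 i2 j : ℕ, i1 < i2 → (i1, j) ∈ skewCells lam mu → (i2, j) ∈ skewCells lam mu →
    entry i1 j < entry i2 j
  /-- Normalization outside the shape. -/
  zeros : ∀ i j : ℕ, (i, j) ∉ skewCells lam mu → entry i j = 0

namespace SkewTableau

/-- The content of a tableau, which is also the exponent of its monomial `x ^ T`:
the value at `k` is the number of boxes with entry `k`. -/
noncomputable def content {lam mu : YoungDiagram} (T : SkewTableau lam mu) : ℕ →₀ ℕ :=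
  ∑ c ∈ skewCells lam mu, Finsupp.single (T.entry c.1 c.2) 1

theorem content_apply {lam mu : YoungDiagram} (T : SkewTableau lam mu) (k : ℕ) :
    T.content k = ((skewCells lam mu).filter (fun c => T.entry c.1 c.2 = k)).card := by
  rw [content, Finsupp.finsetSum_apply, Finset.card_filter]
  exact Finset.sum_congr rfl fun c _ => Finsupp.single_apply

/-- There are finitely many semistandard skew tableaux of given shape and content. -/
instance finite_content_eq (lam mu : YoungDiagram) (d : ℕ →₀ ℕ) :
    Finite {T : SkewTableau lam mu // T.content = d} := by
  have key : ∀ (T : {T : SkewTableau lam mu // T.content = d}) (c : skewCells lam mu),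
      T.1.entry c.1.1 c.1.2 ∈ d.support := by
    intro T c
    have hT := content_apply T.1 (T.1.entry c.1.1 c.1.2)
    rw [T.2] at hT
    rw [Finsupp.mem_support_iff, hT]
    exact Finset.card_ne_zero.mpr ⟨c.1, by simp⟩
  let f : {T : SkewTableau lam mu // T.content = d} → (skewCells lam mu → d.support) :=
    fun T c => ⟨T.1.entry c.1.1 c.1.2, key T c⟩
  refine Finite.of_injective f ?_
  intro T T' h
  apply Subtype.ext
  apply SkewTableau.ext
  funext i j
  by_cases hc : (i, j) ∈ skewCells lam mu
  · exact congrArg Subtype.val (congrFun h ⟨(i, j), hc⟩)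
  · rw [T.1.zeros i j hc, T'.1.zeros i j hc]

end SkewTableau

/-- The skew Schur function `s_{lam/mu} = ∑ x ^ T`, the sum over all semistandard skew tableaux `T`
of shape `lam / mu`, as a formal power series in infinitely many variables: the coefficient of
`x ^ d` is the number of such `T` with content `d` (a finite number). -/
noncomputable def skewSchur (lam mu : YoungDiagram) : MvPowerSeries ℕ ℚ :=
  fun d => (Nat.card {T : SkewTableau lam mu // T.content = d} : ℚ)

/-- The Schur function `s_nu`, which is `s_{nu/∅}`. -/
noncomputable def schur (nu : YoungDiagram) : MvPowerSeries ℕ ℚ :=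
  skewSchur nu ⊥

/-- Restriction to the first `n` variables: all the other variables are set equal to `0`.
The image of `f` is what is meant by `f` in `Λ_n`. -/
noncomputable def restrictVars (n : ℕ) : MvPowerSeries ℕ ℚ →ₐ[ℚ] MvPowerSeries (Fin n) ℚ :=
  MvPowerSeries.killCompl Fin.valEmbedding

/-! ### Boxes, described column by column -/

open Finset

/-! Part 1: entries strictly increase down a column, so a column with more than n boxes needs more
than n letters.

Part 2: fill every column of λ/μ with 0, 1, 2, … . This base tableau is minimal box by box, so its
content dominates that of every other tableau. For n ≥ m, an identity in Λ_n therefore forces the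
base contents of λ/μ and ν to agree (`base_content_eq_of_restrictVars_eq`): the columns of ν are
those of λ/μ, sorted by length.

If any two nonempty columns of λ/μ share a top or a bottom, then all share their top or all share
their bottom, and λ/μ is ν translated or rotated by 180 degrees. The identity then holds in Λ
(`ColumnsNested.tableauCount_eq`). A rotation reverses the order of the letters, so this case needs
the symmetry of s_ν, obtained from Bender-Knuth involutions.

Otherwise two columns, of lengths c ≤ d, are incomparable; choose them with d - c minimal. Let θ be
the base content with one letter c - 1 replaced by d. As d ≤ m < n, the coefficient of x^θ survives
in Λ_n. It is at least d - c + 2 for λ/μ (`shiftedTableau`) but at most d - c + 1 for ν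
(`tableauCount_le_of_rowLen_eq`). So an identity in Λ_n excludes this case
(`columnsNested_of_restrictVars_eq`). -/

theorem mem_skewCells {lam mu : YoungDiagram} {i j : ℕ} :
    (i, j) ∈ skewCells lam mu ↔ mu.colLen j ≤ i ∧ i < lam.colLen j := by
  rw [skewCells, mem_sdiff, YoungDiagram.mem_cells, YoungDiagram.mem_cells,
    YoungDiagram.mem_iff_lt_colLen, YoungDiagram.mem_iff_lt_colLen]
  omega

theorem colLen_bot (j : ℕ) : (⊥ : YoungDiagram).colLen j = 0 := by
  by_contra h
  exact YoungDiagram.notMem_bot (0, j) (YoungDiagram.mem_iff_lt_colLen.2 (Nat.pos_of_ne_zero h))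

theorem mem_skewCells_bot {nu : YoungDiagram} {i j : ℕ} :
    (i, j) ∈ skewCells nu ⊥ ↔ (i, j) ∈ nu := by
  rw [mem_skewCells, colLen_bot, YoungDiagram.mem_iff_lt_colLen]
  omega

theorem mem_skewCells_bot_rowLen {nu : YoungDiagram} {i j : ℕ} :
    (i, j) ∈ skewCells nu ⊥ ↔ j < nu.rowLen i :=
  mem_skewCells_bot.trans YoungDiagram.mem_iff_lt_rowLen

theorem skewColLen_eq (lam mu : YoungDiagram) (j : ℕ) :
    skewColLen lam mu j = lam.colLen j - mu.colLen j := by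
  rw [skewColLen, ← Nat.card_Ico]
  refine card_nbij' (fun c => c.1) (fun i => (i, j)) ?_ ?_ ?_ ?_
  · rintro ⟨i, j'⟩ h
    simp only [coe_filter, Set.mem_ofPred_eq, mem_skewCells] at h
    obtain ⟨h, rfl⟩ := h
    simpa using h
  · intro i h
    simp only [coe_Ico, Set.mem_Ico] at h
    simpa [mem_skewCells] using h
  · rintro ⟨i, j'⟩ h
    simp only [coe_filter, Set.mem_ofPred_eq] at h
    simp [h.2]
  · intro i _
    rfl

theorem colLen_sub_le_longestColumn (lam mu : YoungDiagram) (j : ℕ) :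
    lam.colLen j - mu.colLen j ≤ longestColumn lam mu := by
  rcases Nat.eq_zero_or_pos (lam.colLen j - mu.colLen j) with h | h
  · omega
  · rw [← skewColLen_eq]
    exact le_sup (f := fun c : ℕ × ℕ => skewColLen lam mu c.2)
      (mem_skewCells (i := mu.colLen j).2 ⟨le_rfl, by omega⟩)

theorem exists_longestColumn {lam mu : YoungDiagram} (h : 0 < longestColumn lam mu) :
    ∃ j, lam.colLen j - mu.colLen j = longestColumn lam mu := by
  have hne : (skewCells lam mu).Nonempty := by
    rw [nonempty_iff_ne_empty]
    intro h0
    simp [longestColumn, h0] at h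
  obtain ⟨c, -, hc⟩ := exists_mem_eq_sup _ hne (fun c : ℕ × ℕ => skewColLen lam mu c.2)
  exact ⟨c.2, by rw [← skewColLen_eq]; exact hc.symm⟩

theorem lt_rowLen_zero {lam mu : YoungDiagram} {i j : ℕ} (h : (i, j) ∈ skewCells lam mu) :
    j < lam.rowLen 0 := by
  rw [← YoungDiagram.mem_iff_lt_rowLen, YoungDiagram.mem_iff_lt_colLen]
  have := mem_skewCells.1 h
  omega

theorem sum_skewCells {M : Type*} [AddCommMonoid M] (lam mu : YoungDiagram) (f : ℕ × ℕ → M) :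
    ∑ c ∈ skewCells lam mu, f c = ∑ j ∈ range (lam.rowLen 0),
      ∑ p ∈ range (lam.colLen j - mu.colLen j), f (mu.colLen j + p, j) := by
  rw [sum_sigma']
  refine sum_nbij' (fun c => ⟨c.2, c.1 - mu.colLen c.2⟩) (fun x => (mu.colLen x.1 + x.2, x.1))
    ?_ ?_ ?_ ?_ ?_
  · rintro ⟨i, j⟩ h
    have h1 := mem_skewCells.1 h
    have h2 := lt_rowLen_zero h
    simp only [mem_sigma, mem_range]
    omega
  · rintro ⟨j, p⟩ h
    simp only [mem_sigma, mem_range] at h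
    rw [mem_skewCells]
    dsimp only
    omega
  · rintro ⟨i, j⟩ h
    have h1 := mem_skewCells.1 h
    simp only [Prod.mk.injEq, and_true]
    omega
  · rintro ⟨j, p⟩ h
    simp
  · rintro ⟨i, j⟩ h
    have h1 := mem_skewCells.1 h
    dsimp only
    rw [Nat.add_sub_cancel' h1.1]

/-! ### Coefficients as numbers of tableaux -/

/-- The number of tableaux of shape `lam / mu` and content `d`. -/
noncomputable def tableauCount (lam mu : YoungDiagram) (d : ℕ →₀ ℕ) : ℕ :=
  Nat.card {T : SkewTableau lam mu // T.content = d}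

theorem skewSchur_eq_iff {lam mu lam' mu' : YoungDiagram} :
    skewSchur lam mu = skewSchur lam' mu' ↔
      ∀ d, tableauCount lam mu d = tableauCount lam' mu' d := by
  constructor
  · intro h d
    have h' : (tableauCount lam mu d : ℚ) = tableauCount lam' mu' d := congrFun h d
    exact_mod_cast h'
  · intro h
    funext d
    exact congrArg (Nat.cast (R := ℚ)) (h d)

theorem coeff_restrictVars_skewSchur (n : ℕ) (lam mu : YoungDiagram) (d : Fin n →₀ ℕ) :
    MvPowerSeries.coeff d (restrictVars n (skewSchur lam mu)) =
      tableauCount lam mu (d.embDomain Fin.valEmbedding) := by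
  rw [restrictVars, MvPowerSeries.coeff_killCompl]
  rfl

theorem exists_embDomain_eq {n : ℕ} {d : ℕ →₀ ℕ} (hd : ∀ i, n ≤ i → d i = 0) :
    ∃ d' : Fin n →₀ ℕ, d'.embDomain Fin.valEmbedding = d := by
  have : d ∈ Set.range (Finsupp.embDomain (M := ℕ) (Fin.valEmbedding (n := n))) := by
    rw [Finsupp.mem_range_embDomain_iff]
    intro i hi
    refine ⟨⟨i, ?_⟩, rfl⟩
    by_contra h
    exact (Finsupp.mem_support_iff.1 hi) (hd i (by omega))
  exact this

theorem tableauCount_eq_of_restrictVars_eq {n : ℕ} {lam mu lam' mu' : YoungDiagram}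
    (h : restrictVars n (skewSchur lam mu) = restrictVars n (skewSchur lam' mu'))
    {d : ℕ →₀ ℕ} (hd : ∀ i, n ≤ i → d i = 0) :
    tableauCount lam mu d = tableauCount lam' mu' d := by
  obtain ⟨d', rfl⟩ := exists_embDomain_eq hd
  have := congrArg (MvPowerSeries.coeff d') h
  rw [coeff_restrictVars_skewSchur, coeff_restrictVars_skewSchur] at this
  exact_mod_cast this

theorem tableauCount_pos_iff {lam mu : YoungDiagram} {d : ℕ →₀ ℕ} :
    0 < tableauCount lam mu d ↔ ∃ T : SkewTableau lam mu, T.content = d := by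
  rw [tableauCount, Nat.card_pos_iff, nonempty_subtype]
  exact and_iff_left inferInstance

theorem tableauCount_le_of_injective {lam mu lam' mu' : YoungDiagram} {d d' : ℕ →₀ ℕ}
    (f : SkewTableau lam mu → SkewTableau lam' mu')
    (hf : ∀ T, T.content = d → (f T).content = d') (hinj : Function.Injective f) :
    tableauCount lam mu d ≤ tableauCount lam' mu' d' := by
  refine Nat.card_le_card_of_injective (fun T => ⟨f T.1, hf T.1 T.2⟩) ?_
  intro T T' h
  exact Subtype.ext (hinj (congrArg Subtype.val h))

/-! ### The base tableau and dominance -/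

namespace SkewTableau

variable {lam mu : YoungDiagram}

theorem content_entry_pos (T : SkewTableau lam mu) {i j : ℕ} (h : (i, j) ∈ skewCells lam mu) :
    0 < T.content (T.entry i j) := by
  rw [content_apply]
  exact card_pos.2 ⟨(i, j), by simp [h]⟩

theorem sum_content (T : SkewTableau lam mu) (t : ℕ) :
    ∑ k ∈ range t, T.content k = #{c ∈ skewCells lam mu | T.entry c.1 c.2 < t} := by
  rw [card_eq_sum_card_fiberwise (f := fun c => T.entry c.1 c.2) (t := range t)]
  · refine sum_congr rfl fun k hk => ?_
    rw [content_apply, filter_filter]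
    congr 1
    ext c
    have := mem_range.1 hk
    simp only [mem_filter]
    constructor
    · rintro ⟨h, rfl⟩; exact ⟨h, this, rfl⟩
    · rintro ⟨h, -, h'⟩; exact ⟨h, h'⟩
  · intro c hc
    simpa using (mem_filter.1 hc).2

theorem entry_ge (T : SkewTableau lam mu) {i j : ℕ} (h : (i, j) ∈ skewCells lam mu) :
    i - mu.colLen j ≤ T.entry i j := by
  obtain ⟨h1, h2⟩ := mem_skewCells.1 h
  obtain ⟨p, rfl⟩ := Nat.exists_eq_add_of_le h1
  induction p with
  | zero => omega
  | succ p ih =>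
    have hc : (mu.colLen j + p, j) ∈ skewCells lam mu := mem_skewCells.2 (by omega)
    have := ih hc (by omega) (by omega)
    have := T.col_strict (mu.colLen j + p) (mu.colLen j + (p + 1)) j (by omega) hc h
    omega

variable (lam mu) in
/-- The tableau in which every column is filled with `0, 1, 2, …` from top to bottom. -/
def base : SkewTableau lam mu where
  entry i j := if (i, j) ∈ skewCells lam mu then i - mu.colLen j else 0
  row_weak i j1 j2 hj h1 h2 := by
    have := mu.colLen_anti _ _ hj.le
    simp only [h1, h2, if_true]
    omega
  col_strict i1 i2 j hi h1 h2 := by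
    simp only [h1, h2, if_true]
    have := mem_skewCells.1 h1
    omega
  zeros i j h := by simp only [h, if_false]

theorem base_entry {i j : ℕ} (h : (i, j) ∈ skewCells lam mu) :
    (base lam mu).entry i j = i - mu.colLen j := by
  simp only [base, h, if_true]

/-- Since the base tableau is minimal in each box, a box with entry below `t` in `T` also has one in
the base tableau. This is the dominance order on contents. -/
theorem sum_content_le (T : SkewTableau lam mu) (t : ℕ) :
    ∑ k ∈ range t, T.content k ≤ ∑ k ∈ range t, (base lam mu).content k := by
  rw [sum_content, sum_content]
  refine card_le_card fun c hc => ?_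
  rw [mem_filter] at hc ⊢
  refine ⟨hc.1, ?_⟩
  rw [base_entry hc.1]
  exact (T.entry_ge hc.1).trans_lt hc.2

theorem base_content_apply (k : ℕ) : (base lam mu).content k =
    #{j ∈ range (lam.rowLen 0) | k < lam.colLen j - mu.colLen j} := by
  rw [content_apply, card_filter, sum_skewCells, card_filter]
  refine sum_congr rfl fun j _ => ?_
  have : ∀ p ∈ range (lam.colLen j - mu.colLen j),
      (if (base lam mu).entry (mu.colLen j + p) j = k then 1 else 0) = if p = k then 1 else 0 := by
    intro p hp
    rw [mem_range] at hp
    rw [base_entry (mem_skewCells.2 (by omega)), Nat.add_sub_cancel_left]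
  rw [sum_congr rfl this, sum_ite_eq']
  simp

theorem base_content_bot (nu : YoungDiagram) (k : ℕ) :
    (base nu ⊥).content k = nu.rowLen k := by
  rw [base_content_apply, ← card_range (nu.rowLen k)]
  congr 1
  ext j
  rw [mem_filter, mem_range, mem_range, colLen_bot, Nat.sub_zero,
    ← YoungDiagram.mem_iff_lt_colLen, YoungDiagram.mem_iff_lt_rowLen]
  have := nu.rowLen_anti 0 k (Nat.zero_le _)
  omega

end SkewTableau

theorem eq_of_sum_range_eq {f g : ℕ → ℕ} (h : ∀ t, ∑ k ∈ range t, f k = ∑ k ∈ range t, g k)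
    (k : ℕ) : f k = g k := by
  have h1 := h k
  have h2 := h (k + 1)
  rw [sum_range_succ, sum_range_succ] at h2
  omega

/-- A tableau with entries less than `n` has columns of length at most `n`. -/
theorem SkewTableau.colLen_sub_le {lam mu : YoungDiagram} (T : SkewTableau lam mu) {n : ℕ}
    (hT : ∀ i, n ≤ i → T.content i = 0) (j : ℕ) : lam.colLen j - mu.colLen j ≤ n := by
  by_contra! h
  have hc : (lam.colLen j - 1, j) ∈ skewCells lam mu := mem_skewCells.2 (by omega)
  have h1 := T.entry_ge hc
  have h2 := T.content_entry_pos hc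
  have h3 := hT _ (show n ≤ T.entry (lam.colLen j - 1) j by omega)
  omega

theorem restrictVars_skewSchur_eq_zero {lam mu : YoungDiagram} {n : ℕ}
    (h : n < longestColumn lam mu) : restrictVars n (skewSchur lam mu) = 0 := by
  ext d
  rw [coeff_restrictVars_skewSchur, map_zero, Nat.cast_eq_zero]
  by_contra h0
  obtain ⟨T, hT⟩ := tableauCount_pos_iff.1 (Nat.pos_of_ne_zero h0)
  obtain ⟨j, hj⟩ := exists_longestColumn (by omega : 0 < longestColumn lam mu)
  have := T.colLen_sub_le (n := n) (fun i hi => ?_) j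
  · omega
  · rw [hT]
    refine Finsupp.embDomain_of_notMem_range _ _ _ ?_
    rintro ⟨a, rfl⟩
    have := a.2
    simp at hi
    omega

theorem SkewTableau.base_content_eq_zero {lam mu : YoungDiagram} {n : ℕ}
    (h : ∀ j, lam.colLen j - mu.colLen j ≤ n) (i : ℕ) (hi : n ≤ i) :
    (base lam mu).content i = 0 := by
  rw [base_content_apply, card_eq_zero, filter_eq_empty_iff]
  intro j _
  have := h j
  omega

/-- Each base content occurs as a content of the other shape, so each dominates the other. -/
theorem base_content_eq_of_restrictVars_eq {n : ℕ} {lam mu lam' mu' : YoungDiagram}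
    (h : restrictVars n (skewSchur lam mu) = restrictVars n (skewSchur lam' mu'))
    (hn : ∀ j, lam.colLen j - mu.colLen j ≤ n) :
    (SkewTableau.base lam mu).content = (SkewTableau.base lam' mu').content := by
  have h1 := SkewTableau.base_content_eq_zero hn
  have h2 := tableauCount_eq_of_restrictVars_eq h h1
  obtain ⟨T', hT'⟩ := tableauCount_pos_iff.1
    (h2 ▸ tableauCount_pos_iff.2 ⟨SkewTableau.base lam mu, rfl⟩)
  -- `T'` uses only letters below `n`, which bounds the columns of the second shape as well, so the
  -- roles can be exchanged.
  have h3 := SkewTableau.base_content_eq_zero (T'.colLen_sub_le (by rw [hT']; exact h1))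
  have h4 := tableauCount_eq_of_restrictVars_eq h h3
  obtain ⟨T, hT⟩ := tableauCount_pos_iff.1
    (h4 ▸ tableauCount_pos_iff.2 ⟨SkewTableau.base lam' mu', rfl⟩)
  refine Finsupp.ext (eq_of_sum_range_eq fun t => le_antisymm ?_ ?_)
  · rw [← hT']
    exact T'.sum_content_le t
  · rw [← hT]
    exact T.sum_content_le t

/-! ### Segments of integers -/

/-- An initial segment `S` of `[J, ∞)` is determined by its cardinality. -/
theorem add_mem_iff_lt_card {S : Finset ℕ} {J : ℕ} (hge : ∀ x ∈ S, J ≤ x)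
    (hdown : ∀ x ∈ S, ∀ y, J ≤ y → y ≤ x → y ∈ S) (j : ℕ) : J + j ∈ S ↔ j < #S := by
  constructor
  · intro h
    have : Icc J (J + j) ⊆ S := fun y hy => hdown _ h y (mem_Icc.1 hy).1 (mem_Icc.1 hy).2
    have := card_le_card this
    rw [Nat.card_Icc] at this
    omega
  · intro h
    by_contra hn
    have : S ⊆ Ico J (J + j) := by
      intro x hx
      rw [mem_Ico]
      refine ⟨hge x hx, ?_⟩
      by_contra hlt
      exact hn (hdown x hx _ (by omega) (by omega))
    have := card_le_card this
    rw [Nat.card_Ico] at this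
    omega

/-- A final segment `S` of `[0, R]` is determined by its cardinality. -/
theorem sub_mem_iff_lt_card {S : Finset ℕ} {R : ℕ} (hle : ∀ x ∈ S, x ≤ R)
    (hup : ∀ x ∈ S, ∀ y, y ≤ R → x ≤ y → y ∈ S) (j : ℕ) : j ≤ R ∧ R - j ∈ S ↔ j < #S := by
  constructor
  · rintro ⟨hj, h⟩
    have : Icc (R - j) R ⊆ S := fun y hy => hup _ h y (mem_Icc.1 hy).2 (mem_Icc.1 hy).1
    have := card_le_card this
    rw [Nat.card_Icc] at this
    omega
  · intro h
    by_contra hn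
    have : S ⊆ Ioc (R - j) R := by
      intro x hx
      rw [mem_Ioc]
      refine ⟨?_, hle x hx⟩
      by_contra hlt
      have := hle x hx
      by_cases hj : j ≤ R
      · exact hn ⟨hj, hup x hx _ (by omega) (by omega)⟩
      · have : S ⊆ range (R + 1) := fun y hy => mem_range.2 (by have := hle y hy; omega)
        have := card_le_card this
        rw [card_range] at this
        omega
    have := card_le_card this
    rw [Nat.card_Ioc] at this
    have : S ⊆ range (R + 1) := fun y hy => mem_range.2 (by have := hle y hy; omega)
    have := card_le_card this
    rw [card_range] at this
    omega

/-! ### Bender-Knuth involutions, as toggles of Gelfand-Tsetlin patterns -/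

namespace SkewTableau

variable {nu : YoungDiagram}

/-- The number of entries of row `i` that are less than `t`. -/
def rowCount (T : SkewTableau nu ⊥) (t i : ℕ) : ℕ :=
  #{j ∈ range (nu.rowLen i) | T.entry i j < t}

theorem row_mono (T : SkewTableau nu ⊥) {i j1 j2 : ℕ} (hj : j1 ≤ j2) (h : j2 < nu.rowLen i) :
    T.entry i j1 ≤ T.entry i j2 := by
  rcases hj.eq_or_lt with rfl | hj
  · rfl
  · exact T.row_weak i j1 j2 hj (mem_skewCells_bot_rowLen.2 (hj.trans h))
      (mem_skewCells_bot_rowLen.2 h)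

theorem lt_rowCount_iff (T : SkewTableau nu ⊥) (t i j : ℕ) :
    j < T.rowCount t i ↔ j < nu.rowLen i ∧ T.entry i j < t := by
  rw [rowCount, ← add_mem_iff_lt_card (J := 0) (fun _ _ => Nat.zero_le _), zero_add, mem_filter,
    mem_range]
  intro x hx y _ hy
  rw [mem_filter, mem_range] at hx ⊢
  exact ⟨by omega, (T.row_mono hy hx.1).trans_lt hx.2⟩

theorem rowCount_eq_of_forall (T : SkewTableau nu ⊥) {t i r : ℕ}
    (h : ∀ j, j < r ↔ j < nu.rowLen i ∧ T.entry i j < t) : T.rowCount t i = r := by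
  refine le_antisymm ?_ ?_ <;> by_contra! hlt
  · exact lt_irrefl _ ((h _).2 ((T.lt_rowCount_iff t i _).1 hlt))
  · exact lt_irrefl _ ((T.lt_rowCount_iff t i _).2 ((h _).1 hlt))

theorem rowCount_le_rowLen (T : SkewTableau nu ⊥) (t i : ℕ) : T.rowCount t i ≤ nu.rowLen i := by
  by_contra! h
  exact lt_irrefl _ ((T.lt_rowCount_iff t i _).1 h).1

theorem rowCount_mono (T : SkewTableau nu ⊥) {s t : ℕ} (hst : s ≤ t) (i : ℕ) :
    T.rowCount s i ≤ T.rowCount t i := by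
  by_contra! h
  have h1 := (T.lt_rowCount_iff s i _).1 h
  exact lt_irrefl _ ((T.lt_rowCount_iff t i _).2 ⟨h1.1, by omega⟩)

/-- Column strictness becomes the interlacing of consecutive rows of the Gelfand-Tsetlin pattern
formed by the row counts. -/
theorem rowCount_succ_le (T : SkewTableau nu ⊥) (t i : ℕ) :
    T.rowCount (t + 1) (i + 1) ≤ T.rowCount t i := by
  by_contra! h
  have h1 := (T.lt_rowCount_iff (t + 1) (i + 1) _).1 h
  have h2 := nu.rowLen_anti i (i + 1) (by omega)
  have h3 := T.col_strict i (i + 1) _ (by omega)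
    (mem_skewCells_bot_rowLen.2 (h1.1.trans_le h2)) (mem_skewCells_bot_rowLen.2 h1.1)
  exact lt_irrefl _ ((T.lt_rowCount_iff t i _).2 ⟨by omega, by omega⟩)

theorem content_add_sum_rowCount (T : SkewTableau nu ⊥) (t : ℕ) :
    T.content t + ∑ i ∈ range (nu.colLen 0), T.rowCount t i =
      ∑ i ∈ range (nu.colLen 0), T.rowCount (t + 1) i := by
  have key : ∀ s, ∑ k ∈ range s, T.content k = ∑ i ∈ range (nu.colLen 0), T.rowCount s i := by
    intro s
    rw [sum_content, card_eq_sum_card_fiberwise (f := Prod.fst) (t := range (nu.colLen 0))]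
    · refine sum_congr rfl fun i _ => ?_
      refine card_nbij' Prod.snd (fun j => (i, j)) ?_ ?_ ?_ ?_
      · rintro ⟨i', j⟩ h
        simp only [coe_filter, mem_filter, Set.mem_ofPred_eq, mem_skewCells_bot_rowLen] at h
        obtain ⟨h, rfl⟩ := h
        simpa using h
      · intro j h
        simpa [mem_skewCells_bot_rowLen] using h
      · rintro ⟨i', j⟩ h
        simp only [coe_filter, Set.mem_ofPred_eq] at h
        simp [h.2]
      · intro j _
        rfl
    · rintro ⟨i, j⟩ h
      have h1 := mem_skewCells.1 (mem_filter.1 h).1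
      have h2 := nu.colLen_anti 0 j (Nat.zero_le _)
      simp only [coe_range, Set.mem_Iio]
      omega
  rw [← key, ← key, sum_range_succ, add_comm]

/-- The least possible number of entries at most `k` in row `i`, if all entries other than `k` and
`k + 1` are kept. -/
def toggleLower (T : SkewTableau nu ⊥) (k i : ℕ) : ℕ :=
  max (T.rowCount k i) (T.rowCount (k + 2) (i + 1))

/-- The greatest possible number of entries at most `k` in row `i`, if all entries other than `k`
and `k + 1` are kept. -/
def toggleUpper (T : SkewTableau nu ⊥) (k : ℕ) : ℕ → ℕ
  | 0 => T.rowCount (k + 2) 0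
  | i + 1 => min (T.rowCount (k + 2) (i + 1)) (T.rowCount k i)

theorem toggleUpper_succ (T : SkewTableau nu ⊥) (k i : ℕ) :
    T.toggleUpper k (i + 1) = min (T.rowCount (k + 2) (i + 1)) (T.rowCount k i) := rfl

/-- The number of entries at most `k` in row `i` after the Bender-Knuth involution. -/
def toggleCount (T : SkewTableau nu ⊥) (k i : ℕ) : ℕ :=
  T.toggleLower k i + T.toggleUpper k i - T.rowCount (k + 1) i

/-- With `le_toggleUpper`, this shows that the subtraction in `toggleCount` never truncates: the
toggle reflects the count in the interval of its admissible values. -/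
theorem toggleLower_le (T : SkewTableau nu ⊥) (k i : ℕ) :
    T.toggleLower k i ≤ T.rowCount (k + 1) i :=
  max_le (T.rowCount_mono (by omega) i) (T.rowCount_succ_le (k + 1) i)

theorem le_toggleUpper (T : SkewTableau nu ⊥) (k i : ℕ) :
    T.rowCount (k + 1) i ≤ T.toggleUpper k i := by
  cases i with
  | zero => exact T.rowCount_mono (by omega) 0
  | succ i => exact le_min (T.rowCount_mono (by omega) _) (T.rowCount_succ_le k i)

theorem toggleUpper_le (T : SkewTableau nu ⊥) (k i : ℕ) :
    T.toggleUpper k i ≤ T.rowCount (k + 2) i := by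
  cases i with
  | zero => exact le_rfl
  | succ i => exact min_le_left _ _

theorem toggleCount_bounds (T : SkewTableau nu ⊥) (k i : ℕ) :
    T.rowCount k i ≤ T.toggleCount k i ∧ T.rowCount (k + 2) (i + 1) ≤ T.toggleCount k i ∧
      T.toggleCount k i ≤ T.rowCount (k + 2) i ∧
      T.toggleCount k (i + 1) ≤ T.rowCount k i := by
  have h1 := T.toggleLower_le k i
  have h2 := T.le_toggleUpper k i
  have h3 := T.toggleUpper_le k i
  have h4 := T.toggleLower_le k (i + 1)
  have h5 : T.toggleUpper k (i + 1) ≤ T.rowCount k i := min_le_right _ _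
  have h6 : T.rowCount k i ≤ T.toggleLower k i := le_max_left _ _
  have h7 : T.rowCount (k + 2) (i + 1) ≤ T.toggleLower k i := le_max_right _ _
  unfold toggleCount
  omega

/-- The entries after the Bender-Knuth involution. -/
def toggleEntry (T : SkewTableau nu ⊥) (k i j : ℕ) : ℕ :=
  if j < T.rowCount k i then T.entry i j else if j < T.toggleCount k i then k
    else if j < T.rowCount (k + 2) i then k + 1 else T.entry i j

/-- The four cases are linear in the row counts, which lets `omega` verify the tableau axioms. -/
theorem toggleEntry_spec (T : SkewTableau nu ⊥) (k : ℕ) {i j : ℕ} (hj : j < nu.rowLen i) :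
    (j < T.rowCount k i ∧ T.entry i j < k ∧ T.toggleEntry k i j = T.entry i j) ∨
    (T.rowCount k i ≤ j ∧ j < T.toggleCount k i ∧ j < T.rowCount (k + 2) i ∧
      k ≤ T.entry i j ∧ T.entry i j < k + 2 ∧ T.toggleEntry k i j = k) ∨
    (T.rowCount k i ≤ j ∧ T.toggleCount k i ≤ j ∧ j < T.rowCount (k + 2) i ∧
      k ≤ T.entry i j ∧ T.entry i j < k + 2 ∧ T.toggleEntry k i j = k + 1) ∨
    (T.rowCount (k + 2) i ≤ j ∧ k + 2 ≤ T.entry i j ∧ T.toggleEntry k i j = T.entry i j) := by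
  have h1 := T.lt_rowCount_iff k i j
  have h2 := T.lt_rowCount_iff (k + 2) i j
  have h3 := T.toggleCount_bounds k i
  unfold toggleEntry
  split_ifs <;> omega

/-- The Bender-Knuth involution, which exchanges the multiplicities of `k` and `k + 1`. -/
def toggle (T : SkewTableau nu ⊥) (k : ℕ) : SkewTableau nu ⊥ where
  entry := T.toggleEntry k
  row_weak i j1 j2 hj h1 h2 := by
    have := T.row_weak i j1 j2 hj h1 h2
    rw [mem_skewCells_bot_rowLen] at h1 h2
    have := T.toggleEntry_spec k h1
    have := T.toggleEntry_spec k h2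
    omega
  col_strict i1 i2 j hi h1 h2 := by
    obtain ⟨p, rfl⟩ := Nat.exists_eq_add_of_lt hi
    clear hi
    induction p with
    | zero =>
      have := T.col_strict _ _ j (by omega) h1 h2
      rw [mem_skewCells_bot_rowLen] at h1 h2
      have := T.toggleEntry_spec k h1
      have := T.toggleEntry_spec k h2
      have := T.toggleCount_bounds k i1
      have := T.rowCount_succ_le k i1
      have := T.rowCount_succ_le (k + 1) i1
      simp only [add_zero] at *
      omega
    | succ p ih =>
      have hc : (i1 + p + 1, j) ∈ skewCells nu ⊥ := by
        rw [mem_skewCells] at *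
        omega
      refine (ih hc).trans ?_
      have := T.col_strict _ _ j (by omega : i1 + p + 1 < i1 + (p + 1) + 1) hc h2
      rw [mem_skewCells_bot_rowLen] at hc h2
      have := T.toggleEntry_spec k hc
      have := T.toggleEntry_spec k h2
      have := T.toggleCount_bounds k (i1 + p + 1)
      simp only [← add_assoc] at *
      omega
  zeros i j h := by
    have := T.zeros i j h
    rw [mem_skewCells_bot_rowLen] at h
    have h1 := T.rowCount_le_rowLen k i
    have h2 := T.rowCount_le_rowLen (k + 2) i
    have h3 := T.toggleCount_bounds k i
    unfold toggleEntry
    split_ifs <;> omega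

theorem rowCount_toggle_of_ne (T : SkewTableau nu ⊥) {k t : ℕ} (ht : t ≠ k + 1) (i : ℕ) :
    (T.toggle k).rowCount t i = T.rowCount t i := by
  refine rowCount_eq_of_forall _ fun j => (T.lt_rowCount_iff t i j).trans ?_
  refine and_congr_right fun hj => ?_
  have := T.toggleEntry_spec k hj
  change _ ↔ T.toggleEntry k i j < t
  omega

theorem rowCount_toggle (T : SkewTableau nu ⊥) (k i : ℕ) :
    (T.toggle k).rowCount (k + 1) i = T.toggleCount k i := by
  refine rowCount_eq_of_forall _ fun j => ?_
  change _ ↔ _ ∧ T.toggleEntry k i j < k + 1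
  have h1 := T.toggleCount_bounds k i
  have h2 := T.rowCount_le_rowLen (k + 2) i
  constructor
  · intro h
    have hj : j < nu.rowLen i := by omega
    have := T.toggleEntry_spec k hj
    omega
  · rintro ⟨hj, h⟩
    have := T.toggleEntry_spec k hj
    omega

theorem toggleCount_toggle (T : SkewTableau nu ⊥) (k i : ℕ) :
    (T.toggle k).toggleCount k i = T.rowCount (k + 1) i := by
  have h1 : (T.toggle k).toggleLower k i = T.toggleLower k i := by
    unfold toggleLower
    rw [rowCount_toggle_of_ne _ (by omega), rowCount_toggle_of_ne _ (by omega)]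
  have h2 : (T.toggle k).toggleUpper k i = T.toggleUpper k i := by
    cases i with
    | zero => exact T.rowCount_toggle_of_ne (by omega) 0
    | succ i =>
      rw [toggleUpper_succ, toggleUpper_succ, rowCount_toggle_of_ne _ (by omega),
        rowCount_toggle_of_ne _ (by omega)]
  have h3 := T.toggleLower_le k i
  have h4 := T.le_toggleUpper k i
  rw [toggleCount, rowCount_toggle, h1, h2, toggleCount]
  omega

theorem toggle_toggle (T : SkewTableau nu ⊥) (k : ℕ) : (T.toggle k).toggle k = T := by
  ext i j
  by_cases hc : (i, j) ∈ skewCells nu ⊥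
  · have hj := mem_skewCells_bot_rowLen.1 hc
    have h1 := T.toggleEntry_spec k hj
    have h2 := (T.toggle k).toggleEntry_spec k hj
    rw [toggleCount_toggle, rowCount_toggle_of_ne _ (by omega), rowCount_toggle_of_ne _ (by omega)]
      at h2
    have h3 := T.lt_rowCount_iff (k + 1) i j
    change (T.toggle k).toggleEntry k i j = _
    change _ ∨ _ at h2
    have h4 : (T.toggle k).entry i j = T.toggleEntry k i j := rfl
    rw [h4] at h2
    omega
  · rw [zeros _ _ _ hc, zeros _ _ _ hc]

/-- The lower bound in row `i` and the upper bound in row `i + 1` are the maximum and the minimum of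
the same two counts, so their sum is the sum of those counts. Below the diagram the boundary terms
vanish. -/
theorem sum_toggleLower_add_toggleUpper (T : SkewTableau nu ⊥) (k h : ℕ) :
    ∑ i ∈ range h, (T.toggleLower k i + T.toggleUpper k i) + T.toggleUpper k h =
      ∑ i ∈ range h, (T.rowCount k i + T.rowCount (k + 2) i) + T.rowCount (k + 2) h := by
  induction h with
  | zero => simp [toggleUpper]
  | succ h ih =>
    rw [sum_range_succ, sum_range_succ]
    have : T.toggleLower k h + T.toggleUpper k (h + 1) =
        T.rowCount k h + T.rowCount (k + 2) (h + 1) := by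
      rw [toggleLower, toggleUpper_succ]
      omega
    omega

theorem content_toggle (T : SkewTableau nu ⊥) (k : ℕ) :
    (T.toggle k).content = T.content.equivMapDomain (Equiv.swap k (k + 1)) := by
  have hr : nu.rowLen (nu.colLen 0) = 0 := by
    by_contra h
    exact lt_irrefl _ (YoungDiagram.mem_iff_lt_colLen.1
      (YoungDiagram.mem_iff_lt_rowLen.2 (Nat.pos_of_ne_zero h)))
  have hq : T.rowCount (k + 2) (nu.colLen 0) = 0 := by
    have := T.rowCount_le_rowLen (k + 2) (nu.colLen 0)
    omega
  have hu : T.toggleUpper k (nu.colLen 0) = 0 := by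
    have := T.toggleUpper_le k (nu.colLen 0)
    omega
  have hs := T.sum_toggleLower_add_toggleUpper k (nu.colLen 0)
  have hc : ∑ i ∈ range (nu.colLen 0), T.toggleCount k i +
      ∑ i ∈ range (nu.colLen 0), T.rowCount (k + 1) i =
      ∑ i ∈ range (nu.colLen 0), (T.toggleLower k i + T.toggleUpper k i) := by
    rw [← sum_add_distrib]
    refine sum_congr rfl fun i _ => ?_
    have h3 := T.toggleLower_le k i
    have h4 := T.le_toggleUpper k i
    rw [toggleCount]
    omega
  rw [sum_add_distrib, sum_add_distrib, hq, hu] at hs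
  rw [sum_add_distrib] at hc
  have c0 := T.content_add_sum_rowCount k
  have c1 := T.content_add_sum_rowCount (k + 1)
  have d0 := (T.toggle k).content_add_sum_rowCount k
  have d1 := (T.toggle k).content_add_sum_rowCount (k + 1)
  have e0 : ∀ t ≠ k + 1, ∑ i ∈ range (nu.colLen 0), (T.toggle k).rowCount t i =
      ∑ i ∈ range (nu.colLen 0), T.rowCount t i :=
    fun t ht => sum_congr rfl fun i _ => T.rowCount_toggle_of_ne ht i
  simp only [rowCount_toggle] at d0 d1
  rw [show k + 1 + 1 = k + 2 from rfl] at c1 d1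
  ext t
  rw [Finsupp.equivMapDomain_apply, Equiv.symm_swap]
  rcases eq_or_ne t k with rfl | h1
  · rw [Equiv.swap_apply_left]
    have := e0 t (by omega)
    omega
  · rcases eq_or_ne t (k + 1) with rfl | h2
    · rw [Equiv.swap_apply_right]
      have := e0 (k + 2) (by omega)
      omega
    · rw [Equiv.swap_apply_of_ne_of_ne h1 h2]
      have a0 := T.content_add_sum_rowCount t
      have a1 := (T.toggle k).content_add_sum_rowCount t
      rw [e0 t h2, e0 (t + 1) (by omega)] at a1
      omega

end SkewTableau

/-! ### Symmetry of Schur functions -/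

/-- The permutations of the variables under which `s_nu` is invariant. -/
def tableauCountStabilizer (nu : YoungDiagram) : Submonoid (Equiv.Perm ℕ) where
  carrier := {σ | ∀ d, tableauCount nu ⊥ (d.equivMapDomain σ) = tableauCount nu ⊥ d}
  one_mem' d := by
    congr 1
    exact Finsupp.equivMapDomain_refl d
  mul_mem' {σ τ} hσ hτ d := by
    have : d.equivMapDomain (σ * τ) = (d.equivMapDomain τ).equivMapDomain σ :=
      Finsupp.equivMapDomain_trans τ σ d
    rw [this, hσ, hτ]

theorem swap_succ_mem_stabilizer (nu : YoungDiagram) (k : ℕ) :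
    Equiv.swap k (k + 1) ∈ tableauCountStabilizer nu := by
  have key : ∀ d, tableauCount nu ⊥ d ≤
      tableauCount nu ⊥ (d.equivMapDomain (Equiv.swap k (k + 1))) := by
    intro d
    refine tableauCount_le_of_injective (fun T => T.toggle k) ?_ ?_
    · rintro T rfl
      exact T.content_toggle k
    · exact Function.LeftInverse.injective (g := fun T => T.toggle k) fun T => T.toggle_toggle k
  intro d
  refine le_antisymm ?_ (key d)
  refine (key _).trans_eq ?_
  congr 1
  ext t
  simp [Finsupp.equivMapDomain_apply]

theorem swap_mem_stabilizer (nu : YoungDiagram) (a b : ℕ) :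
    Equiv.swap a b ∈ tableauCountStabilizer nu := by
  wlog hab : a ≤ b generalizing a b
  · rw [Equiv.swap_comm]
    exact this b a (by omega)
  obtain ⟨p, rfl⟩ := Nat.exists_eq_add_of_le hab
  clear hab
  induction p with
  | zero =>
    rw [add_zero, Equiv.swap_self]
    exact (tableauCountStabilizer nu).one_mem
  | succ p ih =>
    rcases Nat.eq_zero_or_pos p with rfl | hp
    · exact swap_succ_mem_stabilizer nu a
    · exact SubmonoidClass.swap_mem_trans _ ih (swap_succ_mem_stabilizer nu (a + p))

/-- Schur functions are symmetric. -/
theorem tableauCount_equivMapDomain (nu : YoungDiagram) {σ : Equiv.Perm ℕ} {N : ℕ}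
    (hσ : ∀ i, N ≤ i → σ i = i) (d : ℕ →₀ ℕ) :
    tableauCount nu ⊥ (d.equivMapDomain σ) = tableauCount nu ⊥ d := by
  have h1 : σ ∈ Subgroup.closure {σ : Equiv.Perm ℕ | σ.IsSwap} := by
    rw [mem_closure_isSwap']
    refine (Set.finite_lt_nat N).subset fun i hi => ?_
    by_contra h
    exact hi (hσ i (not_lt.1 h))
  have h2 : ∀ τ ∈ Subgroup.closure {σ : Equiv.Perm ℕ | σ.IsSwap},
      τ ∈ tableauCountStabilizer nu := by
    intro τ hτ
    induction hτ using Subgroup.closure_induction'' with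
    | one => exact Submonoid.one_mem _
    | mem x hx => obtain ⟨a, b, -, rfl⟩ := hx; exact swap_mem_stabilizer nu a b
    | inv_mem x hx =>
      obtain ⟨a, b, -, rfl⟩ := hx
      rw [Equiv.swap_inv]
      exact swap_mem_stabilizer nu a b
    | mul x y _ _ hx hy => exact Submonoid.mul_mem _ hx hy
  exact h2 σ h1 d

/-! ### Translation and rotation of shapes -/

/-- Reversal of the first `N` natural numbers. -/
def revBelow (N : ℕ) : Equiv.Perm ℕ :=
  Function.Involutive.toPerm (fun i => if i < N then N - 1 - i else i) (by
    intro i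
    dsimp only
    split_ifs <;> omega)

theorem revBelow_apply (N i : ℕ) : revBelow N i = if i < N then N - 1 - i else i := rfl

/-- Transport of tableaux along a relabelling `(i, j) ↦ (r i, s j)` of boxes and a permutation `σ`
of the letters. -/
theorem tableauCount_le_of_relabel {lam mu lam' mu' : YoungDiagram} {d : ℕ →₀ ℕ}
    (σ : Equiv.Perm ℕ) (r s r' s' : ℕ → ℕ)
    (h : ∀ i j, (i, j) ∈ skewCells lam mu →
      (r i, s j) ∈ skewCells lam' mu' ∧ r' (r i) = i ∧ s' (s j) = j)
    (h' : ∀ i j, (i, j) ∈ skewCells lam' mu' →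
      (r' i, s' j) ∈ skewCells lam mu ∧ r (r' i) = i ∧ s (s' j) = j)
    (hrow : ∀ T : SkewTableau lam' mu', T.content = d → ∀ i j1 j2, j1 < j2 →
      (i, j1) ∈ skewCells lam mu → (i, j2) ∈ skewCells lam mu →
      σ (T.entry (r i) (s j1)) ≤ σ (T.entry (r i) (s j2)))
    (hcol : ∀ T : SkewTableau lam' mu', T.content = d → ∀ i1 i2 j, i1 < i2 →
      (i1, j) ∈ skewCells lam mu → (i2, j) ∈ skewCells lam mu →
      σ (T.entry (r i1) (s j)) < σ (T.entry (r i2) (s j))) :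
    tableauCount lam' mu' d ≤ tableauCount lam mu (d.equivMapDomain σ) := by
  let f : {T : SkewTableau lam' mu' // T.content = d} → SkewTableau lam mu := fun T =>
    { entry := fun i j => if (i, j) ∈ skewCells lam mu then σ (T.1.entry (r i) (s j)) else 0
      row_weak := fun i j1 j2 hj h1 h2 => by
        simp only [h1, h2, if_true]
        exact hrow T.1 T.2 i j1 j2 hj h1 h2
      col_strict := fun i1 i2 j hi h1 h2 => by
        simp only [h1, h2, if_true]
        exact hcol T.1 T.2 i1 i2 j hi h1 h2
      zeros := fun i j hc => by simp only [hc, if_false] }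
  have hf : ∀ T i j, (i, j) ∈ skewCells lam mu →
      (f T).entry i j = σ (T.1.entry (r i) (s j)) := fun T i j hc => if_pos hc
  refine Nat.card_le_card_of_injective (fun T => ⟨f T, ?_⟩) ?_
  · obtain ⟨T, rfl⟩ := T
    ext k
    rw [SkewTableau.content_apply, Finsupp.equivMapDomain_apply, SkewTableau.content_apply]
    refine card_nbij' (fun c => (r c.1, s c.2)) (fun c => (r' c.1, s' c.2)) ?_ ?_ ?_ ?_
    · rintro ⟨i, j⟩ hc
      simp only [coe_filter, Set.mem_ofPred_eq] at hc ⊢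
      have := hf ⟨T, rfl⟩ i j hc.1
      rw [hc.2] at this
      exact ⟨(h i j hc.1).1, by rw [this, Equiv.symm_apply_apply]⟩
    · rintro ⟨i, j⟩ hc
      simp only [coe_filter, Set.mem_ofPred_eq] at hc ⊢
      obtain ⟨h1, h2, h3⟩ := h' i j hc.1
      have := hf ⟨T, rfl⟩ _ _ h1
      rw [h2, h3, hc.2, Equiv.apply_symm_apply] at this
      exact ⟨h1, this⟩
    · rintro ⟨i, j⟩ hc
      obtain ⟨-, h2, h3⟩ := h i j (mem_filter.1 hc).1
      simp [h2, h3]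
    · rintro ⟨i, j⟩ hc
      obtain ⟨-, h2, h3⟩ := h' i j (mem_filter.1 hc).1
      simp [h2, h3]
  · intro T T' hTT
    have hTT' : f T = f T' := congrArg Subtype.val hTT
    refine Subtype.ext (SkewTableau.ext ?_)
    funext i j
    by_cases hc : (i, j) ∈ skewCells lam' mu'
    · obtain ⟨h1, h2, h3⟩ := h' i j hc
      have e1 := hf T _ _ h1
      have e2 := hf T' _ _ h1
      rw [hTT', e2, h2, h3] at e1
      exact (σ.injective e1).symm
    · rw [T.1.zeros i j hc, T'.1.zeros i j hc]

theorem tableauCount_le_of_monotone {lam mu lam' mu' : YoungDiagram} (d : ℕ →₀ ℕ)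
    {r s r' s' : ℕ → ℕ} (hr : Monotone r) (hs : Monotone s)
    (h : ∀ i j, (i, j) ∈ skewCells lam mu →
      (r i, s j) ∈ skewCells lam' mu' ∧ r' (r i) = i ∧ s' (s j) = j)
    (h' : ∀ i j, (i, j) ∈ skewCells lam' mu' →
      (r' i, s' j) ∈ skewCells lam mu ∧ r (r' i) = i ∧ s (s' j) = j) :
    tableauCount lam' mu' d ≤ tableauCount lam mu d := by
  have := tableauCount_le_of_relabel (d := d) 1 r s r' s' h h' ?_ ?_
  · rwa [show d.equivMapDomain 1 = d from Finsupp.equivMapDomain_refl d] at this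
  · intro T _ i j1 j2 hj h1 h2
    refine T.row_weak _ _ _ ((hs hj.le).lt_of_ne fun he => ?_) (h _ _ h1).1 (h _ _ h2).1
    have := (h _ _ h1).2.2
    rw [he, (h _ _ h2).2.2] at this
    omega
  · intro T _ i1 i2 j hi h1 h2
    refine T.col_strict _ _ _ ((hr hi.le).lt_of_ne fun he => ?_) (h _ _ h1).1 (h _ _ h2).1
    have := (h _ _ h1).2.1
    rw [he, (h _ _ h2).2.1] at this
    omega

theorem tableauCount_le_of_antitone {lam mu lam' mu' : YoungDiagram} {d : ℕ →₀ ℕ} {N : ℕ}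
    (hd : ∀ i, N ≤ i → d i = 0) {r s r' s' : ℕ → ℕ} (hr : Antitone r) (hs : Antitone s)
    (h : ∀ i j, (i, j) ∈ skewCells lam mu →
      (r i, s j) ∈ skewCells lam' mu' ∧ r' (r i) = i ∧ s' (s j) = j)
    (h' : ∀ i j, (i, j) ∈ skewCells lam' mu' →
      (r' i, s' j) ∈ skewCells lam mu ∧ r (r' i) = i ∧ s (s' j) = j) :
    tableauCount lam' mu' d ≤ tableauCount lam mu (d.equivMapDomain (revBelow N)) := by
  have hN : ∀ T : SkewTableau lam' mu', T.content = d → ∀ i j, (i, j) ∈ skewCells lam' mu' →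
      T.entry i j < N := by
    rintro T rfl i j hc
    by_contra! hlt
    exact (T.content_entry_pos hc).ne' (hd _ hlt)
  refine tableauCount_le_of_relabel (revBelow N) r s r' s' h h' ?_ ?_
  · intro T hT i j1 j2 hj h1 h2
    have e1 := hN T hT _ _ (h _ _ h1).1
    have e2 := hN T hT _ _ (h _ _ h2).1
    have := T.row_weak (r i) (s j2) (s j1) ((hs hj.le).lt_of_ne fun he => ?_)
      (h _ _ h2).1 (h _ _ h1).1
    · rw [revBelow_apply, revBelow_apply, if_pos e1, if_pos e2]
      omega
    · have := (h _ _ h1).2.2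
      rw [← he, (h _ _ h2).2.2] at this
      omega
  · intro T hT i1 i2 j hi h1 h2
    have e1 := hN T hT _ _ (h _ _ h1).1
    have e2 := hN T hT _ _ (h _ _ h2).1
    have := T.col_strict (r i2) (r i1) (s j) ((hr hi.le).lt_of_ne fun he => ?_)
      (h _ _ h2).1 (h _ _ h1).1
    · rw [revBelow_apply, revBelow_apply, if_pos e1, if_pos e2]
      omega
    · have := (h _ _ h1).2.1
      rw [← he, (h _ _ h2).2.1] at this
      omega

/-! ### Nested columns: the shape is a translate or a rotation of ν -/

/-- Any two nonempty columns of `lam / mu` have the same top or the same bottom. -/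
def ColumnsNested (lam mu : YoungDiagram) : Prop :=
  ∀ j k, j < k → mu.colLen j < lam.colLen j → mu.colLen k < lam.colLen k →
    mu.colLen j = mu.colLen k ∨ lam.colLen j = lam.colLen k

/-- Tops and bottoms are monotone in the column index. Given one pair with different tops and
another with different bottoms, the leftmost and the rightmost of these columns would differ at both
ends. -/
theorem ColumnsNested.tops_or_bottoms {lam mu : YoungDiagram} (h : ColumnsNested lam mu) :
    (∀ j k, j < k → mu.colLen j < lam.colLen j → mu.colLen k < lam.colLen k →
      mu.colLen j = mu.colLen k) ∨
    (∀ j k, j < k → mu.colLen j < lam.colLen j → mu.colLen k < lam.colLen k →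
      lam.colLen j = lam.colLen k) := by
  by_contra! hn
  obtain ⟨⟨j, k, hjk, hj, hk, h1⟩, ⟨j', k', hjk', hj', hk', h2⟩⟩ := hn
  have e1 := h j k hjk hj hk
  have e2 := h j' k' hjk' hj' hk'
  have A1 := mu.colLen_anti j k hjk.le
  have A2 := lam.colLen_anti j' k' hjk'.le
  rcases le_or_gt j j' with hjj | hjj
  · have B1 := lam.colLen_anti j j' hjj
    have B2 := mu.colLen_anti j j' hjj
    have e3 := h j k' (by omega) hj hk'
    rcases le_or_gt k k' with hkk | hkk
    · have := mu.colLen_anti k k' hkk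
      omega
    · have := lam.colLen_anti k' k hkk.le
      omega
  · have B1 := lam.colLen_anti j' j hjj.le
    have B2 := mu.colLen_anti j' j hjj.le
    rcases le_or_gt k k' with hkk | hkk
    · have := mu.colLen_anti k k' hkk
      omega
    · have := lam.colLen_anti k' k hkk.le
      have e3 := h j' k (by omega) hj' hk
      omega

/-- The indices of the columns of `lam / mu` with more than `i` boxes. -/
def longColumns (lam mu : YoungDiagram) (i : ℕ) : Finset ℕ :=
  {j ∈ range (lam.rowLen 0) | i < lam.colLen j - mu.colLen j}

theorem mem_longColumns {lam mu : YoungDiagram} {i j : ℕ} :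
    j ∈ longColumns lam mu i ↔ i < lam.colLen j - mu.colLen j := by
  rw [longColumns, mem_filter, mem_range, and_iff_right_iff_imp]
  intro h
  exact lt_rowLen_zero (mem_skewCells (i := mu.colLen j).2 ⟨le_rfl, by omega⟩)

theorem longColumns_card {lam mu nu : YoungDiagram}
    (h : (SkewTableau.base lam mu).content = (SkewTableau.base nu ⊥).content) (i : ℕ) :
    #(longColumns lam mu i) = nu.rowLen i := by
  rw [← SkewTableau.base_content_bot, ← h, SkewTableau.base_content_apply]
  rfl

theorem mem_longColumns_zero {lam mu : YoungDiagram} {i j : ℕ}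
    (h : (i, j) ∈ skewCells lam mu) : j ∈ longColumns lam mu 0 := by
  have := mem_skewCells.1 h
  rw [mem_longColumns]
  omega

theorem tableauCount_eq_of_forall_top_eq {lam mu nu : YoungDiagram}
    (hc : (SkewTableau.base lam mu).content = (SkewTableau.base nu ⊥).content)
    (h : ∀ j k, j < k → mu.colLen j < lam.colLen j → mu.colLen k < lam.colLen k →
      mu.colLen j = mu.colLen k) (d : ℕ →₀ ℕ) :
    tableauCount lam mu d = tableauCount nu ⊥ d := by
  -- `J` is the first nonempty column; it is arbitrary if there is none.
  obtain ⟨J, hJ⟩ : ∃ J, ∀ j ∈ longColumns lam mu 0, J ≤ j ∧ J ∈ longColumns lam mu 0 := by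
    rcases (longColumns lam mu 0).eq_empty_or_nonempty with h0 | h0
    · simp [h0]
    · exact ⟨_, fun j hj => ⟨min'_le _ j hj, min'_mem _ h0⟩⟩
  have top : ∀ j ∈ longColumns lam mu 0, mu.colLen j = mu.colLen J := by
    intro j hj
    obtain ⟨h1, h2⟩ := hJ j hj
    rw [mem_longColumns] at hj h2
    rcases h1.eq_or_lt with rfl | h1
    · rfl
    · exact (h J j h1 (by omega) (by omega)).symm
  have long : ∀ {i x}, x ∈ longColumns lam mu i → x ∈ longColumns lam mu 0 := by
    intro i x hx
    rw [mem_longColumns] at hx ⊢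
    omega
  have key : ∀ i j, J + j ∈ longColumns lam mu i ↔ j < nu.rowLen i := by
    intro i j
    rw [← longColumns_card hc]
    refine add_mem_iff_lt_card (fun x hx => (hJ x (long hx)).1) ?_ j
    intro x hx y hy hyx
    have t := top x (long hx)
    rw [mem_longColumns] at hx ⊢
    have := lam.colLen_anti y x hyx
    have := mu.colLen_anti J y hy
    omega
  have h1 : ∀ i j, (i, j) ∈ skewCells nu ⊥ → (i + mu.colLen J, J + j) ∈ skewCells lam mu ∧
      i + mu.colLen J - mu.colLen J = i ∧ J + j - J = j := by
    intro i j hij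
    rw [mem_skewCells_bot_rowLen, ← key] at hij
    have t := top _ (long hij)
    rw [mem_longColumns] at hij
    rw [mem_skewCells]
    omega
  have h2 : ∀ i j, (i, j) ∈ skewCells lam mu → (i - mu.colLen J, j - J) ∈ skewCells nu ⊥ ∧
      i - mu.colLen J + mu.colLen J = i ∧ J + (j - J) = j := by
    intro i j hij
    have hj := mem_longColumns_zero hij
    have t := top j hj
    have l := (hJ j hj).1
    rw [mem_skewCells] at hij
    rw [mem_skewCells_bot_rowLen, ← key, Nat.add_sub_cancel' l, mem_longColumns]
    omega
  refine le_antisymm (tableauCount_le_of_monotone d (r := fun i => i + mu.colLen J)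
    (s := fun j => J + j) (r' := fun i => i - mu.colLen J) (s' := fun j => j - J) ?_ ?_ h1 h2)
    (tableauCount_le_of_monotone d (r' := fun i => i + mu.colLen J)
    (s' := fun j => J + j) (r := fun i => i - mu.colLen J) (s := fun j => j - J) ?_ ?_ h2 h1) <;>
  · intro x y hxy
    dsimp only
    omega

theorem tableauCount_eq_of_forall_bottom_eq {lam mu nu : YoungDiagram}
    (hc : (SkewTableau.base lam mu).content = (SkewTableau.base nu ⊥).content)
    (h : ∀ j k, j < k → mu.colLen j < lam.colLen j → mu.colLen k < lam.colLen k →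
      lam.colLen j = lam.colLen k) (d : ℕ →₀ ℕ) :
    tableauCount lam mu d = tableauCount nu ⊥ d := by
  obtain ⟨R, hR⟩ : ∃ R, ∀ j ∈ longColumns lam mu 0, j ≤ R ∧ R ∈ longColumns lam mu 0 := by
    rcases (longColumns lam mu 0).eq_empty_or_nonempty with h0 | h0
    · simp [h0]
    · exact ⟨_, fun j hj => ⟨le_max' _ j hj, max'_mem _ h0⟩⟩
  have bottom : ∀ j ∈ longColumns lam mu 0, lam.colLen j = lam.colLen R := by
    intro j hj
    obtain ⟨h1, h2⟩ := hR j hj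
    rw [mem_longColumns] at hj h2
    rcases h1.eq_or_lt with rfl | h1
    · rfl
    · exact h j R h1 (by omega) (by omega)
  have long : ∀ {i x}, x ∈ longColumns lam mu i → x ∈ longColumns lam mu 0 := by
    intro i x hx
    rw [mem_longColumns] at hx ⊢
    omega
  have key : ∀ i j, j ≤ R ∧ R - j ∈ longColumns lam mu i ↔ j < nu.rowLen i := by
    intro i j
    rw [← longColumns_card hc]
    refine sub_mem_iff_lt_card (fun x hx => (hR x (long hx)).1) ?_ j
    intro x hx y hy hyx
    have t := bottom x (long hx)
    rw [mem_longColumns] at hx ⊢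
    have := mu.colLen_anti x y hyx
    have := lam.colLen_anti y R hy
    omega
  have h1 : ∀ i j, (i, j) ∈ skewCells nu ⊥ →
      (lam.colLen R - 1 - i, R - j) ∈ skewCells lam mu ∧
      lam.colLen R - 1 - (lam.colLen R - 1 - i) = i ∧ R - (R - j) = j := by
    intro i j hij
    rw [mem_skewCells_bot_rowLen, ← key] at hij
    have t := bottom _ (long hij.2)
    rw [mem_longColumns] at hij
    rw [mem_skewCells]
    omega
  have h2 : ∀ i j, (i, j) ∈ skewCells lam mu →
      (lam.colLen R - 1 - i, R - j) ∈ skewCells nu ⊥ ∧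
      lam.colLen R - 1 - (lam.colLen R - 1 - i) = i ∧ R - (R - j) = j := by
    intro i j hij
    have hj := mem_longColumns_zero hij
    have t := bottom j hj
    have l := (hR j hj).1
    rw [mem_skewCells] at hij
    rw [mem_skewCells_bot_rowLen, ← key, Nat.sub_sub_self l, mem_longColumns]
    omega
  have anti : ∀ c : ℕ, Antitone fun i => c - i := fun c x y hxy => by
    dsimp only
    omega
  obtain ⟨N, hN⟩ : ∃ N, ∀ i, N ≤ i → d i = 0 := by
    refine ⟨d.support.sup id + 1, fun i hi => ?_⟩
    by_contra hne
    have : i ≤ d.support.sup id := le_sup (f := id) (Finsupp.mem_support_iff.2 hne)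
    omega
  have hrev : ∀ i, N ≤ i → d.equivMapDomain (revBelow N) i = 0 := by
    intro i hi
    rw [Finsupp.equivMapDomain_apply, show (revBelow N).symm i = revBelow N i from rfl,
      revBelow_apply, if_neg (by omega), hN i hi]
  have hinv : (d.equivMapDomain (revBelow N)).equivMapDomain (revBelow N) = d := by
    ext i
    rw [Finsupp.equivMapDomain_apply, Finsupp.equivMapDomain_apply]
    exact congrArg d ((revBelow N).symm_apply_apply i)
  -- Rotation turns content `d` into its reversal; the symmetry of s_ν undoes this.
  have hsymm := tableauCount_equivMapDomain nu (σ := revBelow N) (N := N)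
    (fun i hi => if_neg (by omega)) d
  refine le_antisymm ?_ ?_
  · rw [← hsymm]
    exact tableauCount_le_of_antitone hN (anti _) (anti _) h1 h2
  · rw [← hsymm]
    refine (tableauCount_le_of_antitone hrev (anti _) (anti _) h2 h1).trans_eq ?_
    rw [hinv]

theorem ColumnsNested.tableauCount_eq {lam mu nu : YoungDiagram} (h : ColumnsNested lam mu)
    (hc : (SkewTableau.base lam mu).content = (SkewTableau.base nu ⊥).content) (d : ℕ →₀ ℕ) :
    tableauCount lam mu d = tableauCount nu ⊥ d :=
  h.tops_or_bottoms.elim (fun h => tableauCount_eq_of_forall_top_eq hc h d)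
    (fun h => tableauCount_eq_of_forall_bottom_eq hc h d)

/-! ### Upper bound: tableaux of shape ν and content θ -/

theorem sum_range_single (a t : ℕ) :
    ∑ k ∈ range t, (Finsupp.single a 1 : ℕ →₀ ℕ) k = if a < t then 1 else 0 := by
  simp only [Finsupp.single_apply, sum_ite_eq, mem_range]

/-- Both sides are the sum of `f` over 0, …, `d`. -/
theorem sum_range_skip {M : Type*} [AddCommMonoid M] (f : ℕ → M) {e d : ℕ} (h : e ≤ d) :
    ∑ p ∈ range d, f (if e ≤ p then p + 1 else p) + f e = ∑ p ∈ range d, f p + f d := by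
  induction d, h using Nat.le_induction with
  | base =>
    congr 1
    refine sum_congr rfl fun p hp => ?_
    rw [mem_range] at hp
    rw [if_neg (by omega)]
  | succ d hd ih =>
    rw [sum_range_succ, if_pos hd, add_right_comm, ih, sum_range_succ _ d]

namespace SkewTableau

variable {nu : YoungDiagram}

/-- The boxes of rows `0, …, t - 1` with an entry at least `t`. -/
def exceeding (T : SkewTableau nu ⊥) (t : ℕ) : Finset (ℕ × ℕ) :=
  {c ∈ skewCells nu ⊥ | c.1 < t ∧ t ≤ T.entry c.1 c.2}

theorem mem_exceeding {T : SkewTableau nu ⊥} {t i j : ℕ} :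
    (i, j) ∈ T.exceeding t ↔ j < nu.rowLen i ∧ i < t ∧ t ≤ T.entry i j := by
  rw [exceeding, mem_filter, mem_skewCells_bot_rowLen]

theorem le_entry (T : SkewTableau nu ⊥) {i j : ℕ} (h : j < nu.rowLen i) : i ≤ T.entry i j := by
  have := T.entry_ge (mem_skewCells_bot_rowLen.2 h)
  rwa [colLen_bot] at this

theorem card_exceeding (T : SkewTableau nu ⊥) (t : ℕ) :
    #(T.exceeding t) + ∑ k ∈ range t, T.content k = ∑ k ∈ range t, (base nu ⊥).content k := by
  rw [sum_content, sum_content, ← card_filter_add_card_filter_not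
    (p := fun c => T.entry c.1 c.2 < t) (s := {c ∈ skewCells nu ⊥ | (base nu ⊥).entry c.1 c.2 < t}), add_comm]
  congr 2
  · ext ⟨i, j⟩
    simp only [mem_filter, and_assoc]
    refine and_congr_right fun hc => ?_
    have := T.entry_ge hc
    rw [base_entry hc]
    omega
  · ext ⟨i, j⟩
    simp only [exceeding, mem_filter, and_assoc]
    refine and_congr_right fun hc => ?_
    rw [base_entry hc, colLen_bot]
    omega

variable {c d : ℕ} {θ : ℕ →₀ ℕ}

/-- Thus exactly one box exceeds level `t` when `c ≤ t ≤ d`, and none otherwise. The hypothesis on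
`θ` is additive to avoid subtraction. -/
theorem card_exceeding_of_content
    (hθ : θ + Finsupp.single (c - 1) 1 = (base nu ⊥).content + Finsupp.single d 1)
    (hc : 1 ≤ c) {T : SkewTableau nu ⊥} (hT : T.content = θ) (t : ℕ) :
    #(T.exceeding t) + (if d < t then 1 else 0) = if c ≤ t then 1 else 0 := by
  have h1 := T.card_exceeding t
  have h2 : ∑ k ∈ range t, (θ + Finsupp.single (c - 1) 1 : ℕ →₀ ℕ) k =
    ∑ k ∈ range t, ((base nu ⊥).content + Finsupp.single d 1 : ℕ →₀ ℕ) k := by rw [hθ]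
  simp only [Finsupp.add_apply, sum_add_distrib, sum_range_single] at h2
  rw [hT] at h1
  split_ifs at h2 ⊢ <;> omega

theorem exceeding_unique
    (hθ : θ + Finsupp.single (c - 1) 1 = (base nu ⊥).content + Finsupp.single d 1)
    (hc : 1 ≤ c) {T : SkewTableau nu ⊥} (hT : T.content = θ) {t : ℕ} {x y : ℕ × ℕ}
    (hx : x ∈ T.exceeding t) (hy : y ∈ T.exceeding t) : c ≤ t ∧ t ≤ d ∧ x = y := by
  have ht := card_exceeding_of_content hθ hc hT t
  have hpos := card_pos.2 ⟨x, hx⟩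
  have hle : #(T.exceeding t) ≤ 1 := by split_ifs at ht <;> omega
  refine ⟨?_, ?_, card_le_one.1 hle x hx y hy⟩ <;> split_ifs at ht <;> omega

theorem exceeding_nonempty
    (hθ : θ + Finsupp.single (c - 1) 1 = (base nu ⊥).content + Finsupp.single d 1)
    (hc : 1 ≤ c) {T : SkewTableau nu ⊥} (hT : T.content = θ) {t : ℕ} (h1 : c ≤ t) (h2 : t ≤ d) :
    ∃ i j, (i, j) ∈ T.exceeding t := by
  have ht := card_exceeding_of_content hθ hc hT t
  rw [if_neg (by omega), if_pos h1] at ht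
  obtain ⟨⟨i, j⟩, h⟩ := card_pos.1 (by omega : 0 < #(T.exceeding t))
  exact ⟨i, j, h⟩

/-- The box to the right of an exceeding box would exceed too, and so would the box below it if that
lies in the diagram and in a row before `t`. Uniqueness forbids both, and equal row lengths supply
the box below. -/
theorem exceeding_position
    (hθ : θ + Finsupp.single (c - 1) 1 = (base nu ⊥).content + Finsupp.single d 1)
    (hc : 1 ≤ c) (hrow : ∀ i, c ≤ i → i + 1 < d → nu.rowLen (i + 1) = nu.rowLen i)
    {T : SkewTableau nu ⊥} (hT : T.content = θ) {t i j : ℕ} (h : (i, j) ∈ T.exceeding t) :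
    (i = c - 1 ∨ i = t - 1) ∧ j = nu.rowLen i - 1 := by
  obtain ⟨h1, h2, -⟩ := exceeding_unique hθ hc hT h h
  obtain ⟨hj, hit, hte⟩ := mem_exceeding.1 h
  constructor
  · have hi : c ≤ i + 1 := by
      have h' : (i, j) ∈ T.exceeding (i + 1) := mem_exceeding.2 ⟨hj, by omega, by omega⟩
      exact (exceeding_unique hθ hc hT h' h').1
    by_contra! hne
    have hr := hrow i (by omega) (by omega)
    have hcol := T.col_strict i (i + 1) j (by omega) (mem_skewCells_bot_rowLen.2 hj)
      (mem_skewCells_bot_rowLen.2 (hr ▸ hj))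
    have h' : (i + 1, j) ∈ T.exceeding t := mem_exceeding.2 ⟨hr ▸ hj, by omega, by omega⟩
    have := (exceeding_unique hθ hc hT h h').2.2
    simp at this
  · by_contra hne
    have hj' : j + 1 < nu.rowLen i := by omega
    have := T.row_mono (Nat.le_add_right j 1) hj'
    have h' : (i, j + 1) ∈ T.exceeding t := mem_exceeding.2 ⟨hj', hit, by omega⟩
    have := (exceeding_unique hθ hc hT h h').2.2
    simp at this

theorem exceeding_subset
    (hθ : θ + Finsupp.single (c - 1) 1 = (base nu ⊥).content + Finsupp.single d 1)
    (hc : 1 ≤ c) (hrow : ∀ i, c ≤ i → i + 1 < d → nu.rowLen (i + 1) = nu.rowLen i)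
    {T T' : SkewTableau nu ⊥} (hT : T.content = θ) (hT' : T'.content = θ)
    (he : T.entry (c - 1) (nu.rowLen (c - 1) - 1) = T'.entry (c - 1) (nu.rowLen (c - 1) - 1))
    {t i j : ℕ} (h : (i, j) ∈ T.exceeding t) : (i, j) ∈ T'.exceeding t := by
  obtain ⟨h1, h2, -⟩ := exceeding_unique hθ hc hT h h
  obtain ⟨hi, rfl⟩ := exceeding_position hθ hc hrow hT h
  obtain ⟨i', j', h'⟩ := exceeding_nonempty hθ hc hT' h1 h2
  obtain ⟨hi', rfl⟩ := exceeding_position hθ hc hrow hT' h'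
  by_cases hii : i = i'
  · rwa [hii]
  have m := mem_exceeding.1 h
  have m' := mem_exceeding.1 h'
  by_cases hic : i = c - 1
  · subst hic
    rw [he] at m
    exact mem_exceeding.2 m
  · have hic' : i' = c - 1 := by omega
    subst hic'
    rw [← he] at m'
    have := (exceeding_unique hθ hc hT h (mem_exceeding.2 m')).2.2
    exact absurd (congrArg Prod.fst this) hic

/-- At each level the exceeding box is the end of row `c - 1` or of row `t - 1`, and the entry at
the end of row `c - 1` decides which. The exceeding boxes at all levels determine the tableau. -/
theorem eq_of_entry_eq
    (hθ : θ + Finsupp.single (c - 1) 1 = (base nu ⊥).content + Finsupp.single d 1)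
    (hc : 1 ≤ c) (hrow : ∀ i, c ≤ i → i + 1 < d → nu.rowLen (i + 1) = nu.rowLen i)
    {T T' : SkewTableau nu ⊥} (hT : T.content = θ) (hT' : T'.content = θ)
    (he : T.entry (c - 1) (nu.rowLen (c - 1) - 1) = T'.entry (c - 1) (nu.rowLen (c - 1) - 1)) :
    T = T' := by
  have key : ∀ {T T' : SkewTableau nu ⊥}, T.content = θ → T'.content = θ →
      T.entry (c - 1) (nu.rowLen (c - 1) - 1) = T'.entry (c - 1) (nu.rowLen (c - 1) - 1) →
      ∀ i j, j < nu.rowLen i → T.entry i j ≤ T'.entry i j := by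
    intro T T' hT hT' he i j hj
    by_contra! hlt
    have := T'.le_entry hj
    have := exceeding_subset hθ hc hrow hT hT' he
      (mem_exceeding.2 ⟨hj, by omega, le_refl (T.entry i j)⟩)
    have := (mem_exceeding.1 this).2.2
    omega
  ext i j
  by_cases hj : (i, j) ∈ skewCells nu ⊥
  · rw [mem_skewCells_bot_rowLen] at hj
    exact le_antisymm (key hT hT' he i j hj) (key hT' hT he.symm i j hj)
  · rw [T.zeros i j hj, T'.zeros i j hj]

theorem entry_mem_Icc
    (hθ : θ + Finsupp.single (c - 1) 1 = (base nu ⊥).content + Finsupp.single d 1)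
    (hc : 1 ≤ c) (hcd : c ≤ d)
    (hrow : ∀ i, c ≤ i → i + 1 < d → nu.rowLen (i + 1) = nu.rowLen i)
    {T : SkewTableau nu ⊥} (hT : T.content = θ) :
    T.entry (c - 1) (nu.rowLen (c - 1) - 1) ∈ Icc c d := by
  obtain ⟨i, j, h⟩ := exceeding_nonempty hθ hc hT le_rfl hcd
  obtain ⟨hi, rfl⟩ := exceeding_position hθ hc hrow hT h
  obtain rfl : i = c - 1 := by omega
  have m := mem_exceeding.1 h
  refine mem_Icc.2 ⟨m.2.2, ?_⟩
  have h' := mem_exceeding.2 ⟨m.1, by omega, le_refl (T.entry (c - 1) (nu.rowLen (c - 1) - 1))⟩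
  exact (exceeding_unique hθ hc hT h' h').2.1

end SkewTableau

theorem tableauCount_le_of_rowLen_eq {nu : YoungDiagram} {c d : ℕ} {θ : ℕ →₀ ℕ}
    (hθ : θ + Finsupp.single (c - 1) 1 = (SkewTableau.base nu ⊥).content + Finsupp.single d 1)
    (hc : 1 ≤ c) (hcd : c ≤ d)
    (hrow : ∀ i, c ≤ i → i + 1 < d → nu.rowLen (i + 1) = nu.rowLen i) :
    tableauCount nu ⊥ θ ≤ d + 1 - c := by
  rw [← Nat.card_Icc, ← Nat.card_eq_finsetCard, tableauCount]
  refine Nat.card_le_card_of_injective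
    (fun T => (⟨_, SkewTableau.entry_mem_Icc hθ hc hcd hrow T.2⟩ : Icc c d)) ?_
  intro T T' h
  exact Subtype.ext (SkewTableau.eq_of_entry_eq hθ hc hrow T.2 T'.2 (congrArg Subtype.val h))

/-! ### Lower bound: tableaux from a pair of incomparable columns -/

/-- Columns `j` and `k` of `lam / mu` are nonempty and neither contains the rows of the other. -/
def ColumnsIncomparable (lam mu : YoungDiagram) (j k : ℕ) : Prop :=
  mu.colLen j < lam.colLen j ∧ mu.colLen k < lam.colLen k ∧
    (mu.colLen k < mu.colLen j ∧ lam.colLen k < lam.colLen j ∨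
      mu.colLen j < mu.colLen k ∧ lam.colLen j < lam.colLen k)

theorem exists_last_column {lam mu : YoungDiagram} {j : ℕ} (h : mu.colLen j < lam.colLen j) :
    ∃ x, mu.colLen x = mu.colLen j ∧ lam.colLen x = lam.colLen j ∧
      ¬ (mu.colLen (x + 1) = mu.colLen x ∧ lam.colLen (x + 1) = lam.colLen x) := by
  by_contra! hn
  have key : ∀ p, mu.colLen (j + p) = mu.colLen j ∧ lam.colLen (j + p) = lam.colLen j := by
    intro p
    induction p with
    | zero => exact ⟨rfl, rfl⟩
    | succ p ih =>
      have := hn (j + p) ih.1 ih.2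
      rw [← add_assoc, this.1, this.2]
      exact ih
  have h1 := key (lam.rowLen 0)
  have h2 := lt_rowLen_zero (lam := lam) (mu := mu) (i := mu.colLen j) (j := j + lam.rowLen 0)
    (mem_skewCells.2 (by omega))
  omega

/-- A pair of incomparable columns with minimal difference of lengths. -/
theorem exists_minimal_incomparable {lam mu : YoungDiagram} (h : ¬ ColumnsNested lam mu) :
    ∃ j k, ColumnsIncomparable lam mu j k ∧
      lam.colLen j - mu.colLen j ≤ lam.colLen k - mu.colLen k ∧
      (∀ x y, ColumnsIncomparable lam mu x y →
        lam.colLen x - mu.colLen x ≤ lam.colLen y - mu.colLen y →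
        (lam.colLen k - mu.colLen k) - (lam.colLen j - mu.colLen j) ≤
          (lam.colLen y - mu.colLen y) - (lam.colLen x - mu.colLen x)) ∧
      ¬ (mu.colLen (j + 1) = mu.colLen j ∧ lam.colLen (j + 1) = lam.colLen j) ∧
      ¬ (mu.colLen (k + 1) = mu.colLen k ∧ lam.colLen (k + 1) = lam.colLen k) := by
  classical
  have hex : ∃ n j k, ColumnsIncomparable lam mu j k ∧
      lam.colLen j - mu.colLen j ≤ lam.colLen k - mu.colLen k ∧
      (lam.colLen k - mu.colLen k) - (lam.colLen j - mu.colLen j) = n := by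
    unfold ColumnsNested at h
    push Not at h
    obtain ⟨j, k, hjk, hj, hk, ha, hb⟩ := h
    have := mu.colLen_anti j k hjk.le
    have := lam.colLen_anti j k hjk.le
    rcases le_total (lam.colLen j - mu.colLen j) (lam.colLen k - mu.colLen k) with hl | hl
    · exact ⟨_, j, k, ⟨hj, hk, by omega⟩, hl, rfl⟩
    · exact ⟨_, k, j, ⟨hk, hj, by omega⟩, hl, rfl⟩
  obtain ⟨j₀, k₀, hinc, hle, hn⟩ := Nat.find_spec hex
  obtain ⟨j, hj1, hj2, hj3⟩ := exists_last_column hinc.1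
  obtain ⟨k, hk1, hk2, hk3⟩ := exists_last_column hinc.2.1
  refine ⟨j, k, ?_, ?_, ?_, hj3, hk3⟩
  · unfold ColumnsIncomparable at hinc ⊢
    omega
  · omega
  · intro x y hxy hl
    have := Nat.find_min' hex ⟨x, y, hxy, hl, rfl⟩
    omega

/-- The base tableau with the last entry of column `j` replaced by `e`, and the entries of
column `k` that are at least `e` increased by one. -/
def shiftedEntry (lam mu : YoungDiagram) (j k e i x : ℕ) : ℕ :=
  if (i, x) ∈ skewCells lam mu then
    if x = j ∧ i + 1 = lam.colLen j then e
    else if x = k ∧ mu.colLen k + e ≤ i then i - mu.colLen k + 1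
    else i - mu.colLen x
  else 0

section Shifted

variable {lam mu : YoungDiagram} {j k e : ℕ}

theorem shiftedEntry_spec (he1 : lam.colLen j - mu.colLen j ≤ e + 1) {i x : ℕ}
    (h : (i, x) ∈ skewCells lam mu) :
    i - mu.colLen x ≤ shiftedEntry lam mu j k e i x ∧
    (¬ (x = k ∧ mu.colLen k + e ≤ i) ∧ shiftedEntry lam mu j k e i x = i - mu.colLen x ∨
      x = j ∧ i + 1 = lam.colLen j ∧ shiftedEntry lam mu j k e i x = e ∨
      x = k ∧ mu.colLen k + e ≤ i ∧
        shiftedEntry lam mu j k e i x = i - mu.colLen k + 1) := by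
  have hm := mem_skewCells.1 h
  unfold shiftedEntry
  rw [if_pos h]
  split_ifs with h1 h2
  · obtain ⟨rfl, h1⟩ := h1
    omega
  · obtain ⟨rfl, h2⟩ := h2
    omega
  · omega

/-- The tableau with entries `shiftedEntry`. -/
def shiftedTableau (hinc : ColumnsIncomparable lam mu j k)
    (hle : lam.colLen j - mu.colLen j ≤ lam.colLen k - mu.colLen k)
    (hmin : ∀ x y, ColumnsIncomparable lam mu x y →
        lam.colLen x - mu.colLen x ≤ lam.colLen y - mu.colLen y →
        (lam.colLen k - mu.colLen k) - (lam.colLen j - mu.colLen j) ≤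
          (lam.colLen y - mu.colLen y) - (lam.colLen x - mu.colLen x))
    (hj : ¬ (mu.colLen (j + 1) = mu.colLen j ∧ lam.colLen (j + 1) = lam.colLen j))
    (hk : ¬ (mu.colLen (k + 1) = mu.colLen k ∧ lam.colLen (k + 1) = lam.colLen k))
    (he1 : lam.colLen j - mu.colLen j ≤ e + 1) (he2 : e ≤ lam.colLen k - mu.colLen k) :
    SkewTableau lam mu where
  entry := shiftedEntry lam mu j k e
  row_weak i x y hxy hx hy := by
    have sx := shiftedEntry_spec (k := k) he1 hx
    have sy := shiftedEntry_spec (k := k) he1 hy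
    rw [mem_skewCells] at hx hy
    have a1 := mu.colLen_anti x y hxy.le
    have a2 := lam.colLen_anti x y hxy.le
    have a3 := mu.colLen_anti (x + 1) y hxy
    have a4 := lam.colLen_anti (x + 1) y hxy
    have a5 := mu.colLen_anti x (x + 1) (by omega)
    have a6 := lam.colLen_anti x (x + 1) (by omega)
    obtain ⟨sx, ⟨-, h⟩ | ⟨rfl, hi, h⟩ | ⟨rfl, hi, h⟩⟩ := sx
    · omega
    · by_contra! hlt
      -- A smaller entry in column `y` forces `y` to end in the same row as the short column and to
      -- have length between c and d. Were `y` and `k` incomparable, minimality would make `y` a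
      -- copy of the short column, which is the last of its kind. So they are comparable, and the
      -- original pair would be too.
      have hlong : lam.colLen y - mu.colLen y ≤ lam.colLen k - mu.colLen k := by omega
      have h1 : ¬ ColumnsIncomparable lam mu y k := fun hyk => by
        have := hmin y k hyk hlong
        omega
      unfold ColumnsIncomparable at hinc h1
      omega
    · by_contra! hlt
      -- The same argument for the long column: here `y` shares its top.
      have h1 : ¬ ColumnsIncomparable lam mu j y := fun hjy => by
        have := hmin j y hjy (by omega)
        omega
      unfold ColumnsIncomparable at hinc h1
      omega
  col_strict i1 i2 x hi h1 h2 := by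
    have s1 := shiftedEntry_spec (k := k) he1 h1
    have s2 := shiftedEntry_spec (k := k) he1 h2
    have hjk : j ≠ k := by
      rintro rfl
      unfold ColumnsIncomparable at hinc
      omega
    rw [mem_skewCells] at h1 h2
    clear hmin hinc hj hk
    obtain ⟨s1, ⟨-, h⟩ | ⟨rfl, hi1, h⟩ | ⟨rfl, hi1, h⟩⟩ := s1
    · omega
    · omega
    · omega
  zeros i x h := by
    unfold shiftedEntry
    rw [if_neg h]

theorem content_add_of_entry_eq_shiftedEntry (hjk : j ≠ k) (hj : mu.colLen j < lam.colLen j)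
    (hk : mu.colLen k < lam.colLen k) (he2 : e ≤ lam.colLen k - mu.colLen k)
    {T : SkewTableau lam mu} (hT : T.entry = shiftedEntry lam mu j k e) :
    T.content + Finsupp.single (lam.colLen j - mu.colLen j - 1) 1 =
      (SkewTableau.base lam mu).content + Finsupp.single (lam.colLen k - mu.colLen k) 1 := by
  have hjW := lt_rowLen_zero (mem_skewCells (mu := mu) (i := mu.colLen j).2 ⟨le_rfl, hj⟩)
  have hkW := lt_rowLen_zero (mem_skewCells (mu := mu) (i := mu.colLen k).2 ⟨le_rfl, hk⟩)
  -- Relative to the base tableau, column `j` trades its last letter for `e`, and column `k` trades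
  -- `e` for its length. The two terms in `e` cancel after summation, so the content is independent
  -- of `e`.
  have key : ∀ x, (∑ p ∈ range (lam.colLen x - mu.colLen x),
        (Finsupp.single (T.entry (mu.colLen x + p) x) 1 : ℕ →₀ ℕ)) +
      ((if x = j then Finsupp.single (lam.colLen j - mu.colLen j - 1) 1 else 0) +
        if x = k then Finsupp.single e 1 else 0) =
      (∑ p ∈ range (lam.colLen x - mu.colLen x),
        (Finsupp.single ((SkewTableau.base lam mu).entry (mu.colLen x + p) x) 1 : ℕ →₀ ℕ)) +
      ((if x = k then Finsupp.single (lam.colLen k - mu.colLen k) 1 else 0) +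
        if x = j then Finsupp.single e 1 else 0) := by
    intro x
    have hbase : ∀ p ∈ range (lam.colLen x - mu.colLen x),
        (Finsupp.single ((SkewTableau.base lam mu).entry (mu.colLen x + p) x) 1 : ℕ →₀ ℕ) =
          Finsupp.single p 1 := by
      intro p hp
      rw [mem_range] at hp
      rw [SkewTableau.base_entry (mem_skewCells.2 (by omega)), Nat.add_sub_cancel_left]
    have hentry : ∀ p, p < lam.colLen x - mu.colLen x → T.entry (mu.colLen x + p) x =
        if x = j ∧ mu.colLen x + p + 1 = lam.colLen j then e
        else if x = k ∧ mu.colLen k + e ≤ mu.colLen x + p then mu.colLen x + p - mu.colLen k + 1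
        else p := by
      intro p hp
      rw [hT, shiftedEntry, if_pos (mem_skewCells.2 (by omega)), Nat.add_sub_cancel_left]
    rw [sum_congr rfl hbase]
    by_cases hxj : x = j
    · subst hxj
      rw [if_pos rfl, if_neg hjk, if_neg hjk, if_pos rfl]
      obtain ⟨q, hq⟩ : ∃ q, lam.colLen x - mu.colLen x = q + 1 :=
        ⟨lam.colLen x - mu.colLen x - 1, by omega⟩
      rw [hq, sum_range_succ, sum_range_succ, hentry q (by omega), if_pos ⟨rfl, by omega⟩,
        Nat.add_sub_cancel, add_zero, zero_add, add_right_comm]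
      congr 2
      refine sum_congr rfl fun p hp => ?_
      rw [mem_range] at hp
      rw [hentry p (by omega), if_neg (by omega), if_neg (by omega)]
    · by_cases hxk : x = k
      · subst hxk
        rw [if_neg hxj, if_neg hxj, if_pos rfl, if_pos rfl, zero_add, add_zero,
          ← sum_range_skip (fun p => (Finsupp.single p 1 : ℕ →₀ ℕ)) he2]
        congr 1
        refine sum_congr rfl fun p hp => ?_
        rw [mem_range] at hp
        rw [hentry p hp, if_neg (by omega), Nat.add_sub_cancel_left]
        congr 1
        split_ifs <;> omega
      · rw [if_neg hxj, if_neg hxj, if_neg hxk, if_neg hxk]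
        congr 1
        refine sum_congr rfl fun p hp => ?_
        rw [mem_range] at hp
        rw [hentry p hp, if_neg (by omega), if_neg (by omega)]
  have hsum := sum_congr (rfl : range (lam.rowLen 0) = _) fun x _ => key x
  simp only [sum_add_distrib, sum_ite_eq', mem_range, hjW, hkW, if_true] at hsum
  rw [SkewTableau.content, SkewTableau.content, sum_skewCells, sum_skewCells]
  rw [← add_assoc, ← add_assoc] at hsum
  exact add_right_cancel hsum

end Shifted

theorem ColumnsIncomparable.ne {lam mu : YoungDiagram} {j k : ℕ}
    (h : ColumnsIncomparable lam mu j k) : j ≠ k := by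
  rintro rfl
  unfold ColumnsIncomparable at h
  omega

theorem columnsNested_of_restrictVars_eq {lam mu nu : YoungDiagram} {n : ℕ}
    (hn : longestColumn lam mu < n)
    (h : restrictVars n (skewSchur lam mu) = restrictVars n (skewSchur nu ⊥)) :
    ColumnsNested lam mu := by
  have hlen := colLen_sub_le_longestColumn lam mu
  have hbase := base_content_eq_of_restrictVars_eq h fun x => (hlen x).trans hn.le
  by_contra hnest
  obtain ⟨j, k, hinc, hle, hmin, hj, hk⟩ := exists_minimal_incomparable hnest
  let T := fun e he1 he2 => shiftedTableau (e := e) hinc hle hmin hj hk he1 he2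
  have hT := fun e he1 he2 => content_add_of_entry_eq_shiftedEntry hinc.ne hinc.1 hinc.2.1 he2
    (T := T e he1 he2) rfl
  have hjk := hinc.ne
  obtain ⟨hj0, hk0, hinc'⟩ := hinc
  obtain ⟨c, hc⟩ : ∃ c, c = lam.colLen j - mu.colLen j := ⟨_, rfl⟩
  obtain ⟨d, hd⟩ : ∃ d, d = lam.colLen k - mu.colLen k := ⟨_, rfl⟩
  have hlk := hlen k
  have hlj := hlen j
  have hθ := hT d (by omega) (by omega)
  obtain ⟨θ, hθd⟩ : ∃ θ, θ = (T d (by omega) (by omega)).content := ⟨_, rfl⟩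
  rw [← hθd] at hθ
  have hT' : ∀ e he1 he2, (T e he1 he2).content = θ := fun e he1 he2 =>
    add_right_cancel ((hT e he1 he2).trans hθ.symm)
  -- The new letter `d` is at most the longest column length, hence below `n` by the strict
  -- inequality.
  have hsupp : ∀ i, n ≤ i → θ i = 0 := by
    intro i hi
    have := DFunLike.congr_fun hθ i
    rw [Finsupp.add_apply, Finsupp.add_apply, Finsupp.single_apply, Finsupp.single_apply,
      SkewTableau.base_content_eq_zero (fun x => (hlen x).trans hn.le) i hi,
      if_neg (by omega), if_neg (by omega)] at this
    exact this
  have hcount := tableauCount_eq_of_restrictVars_eq h hsupp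
  have hupper : tableauCount nu ⊥ θ ≤ d + 1 - c := by
    refine tableauCount_le_of_rowLen_eq (by rw [← hbase, hc, hd]; exact hθ) (by omega) (by omega) ?_
    -- No column has length strictly between `c` and `d`: by minimality it would be comparable with
    -- both columns, hence contain `j` and lie within `k` as row intervals.
    intro i hi1 hi2
    rw [← longColumns_card hbase, ← longColumns_card hbase]
    congr 1
    ext x
    rw [mem_longColumns, mem_longColumns]
    by_contra hne
    have hx : lam.colLen x - mu.colLen x = i + 1 := by omega
    have h1 : ¬ ColumnsIncomparable lam mu j x := fun hjx => by
      have := hmin j x hjx (by omega)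
      omega
    have h2 : ¬ ColumnsIncomparable lam mu x k := fun hxk => by
      have := hmin x k hxk (by omega)
      omega
    unfold ColumnsIncomparable at h1 h2
    omega
  have hlower : d + 1 - (c - 1) ≤ tableauCount lam mu θ := by
    rw [← Nat.card_Icc, ← Nat.card_eq_finsetCard, tableauCount]
    have hI : ∀ e : Icc (c - 1) d, c ≤ e.1 + 1 ∧ e.1 ≤ d := fun e => by
      have := mem_Icc.1 e.2
      omega
    refine Nat.card_le_card_of_injective (fun e : Icc (c - 1) d =>
      (⟨T e.1 (hc ▸ (hI e).1) (hd ▸ (hI e).2), hT' _ _ _⟩ :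
        {T : SkewTableau lam mu // T.content = θ})) ?_
    intro e e' hee
    -- The bottom entry of column `j` recovers `e`.
    have h1 := congrFun (congrFun (congrArg (fun S => S.1.entry) hee) (lam.colLen j - 1)) j
    change shiftedEntry lam mu j k e.1 (lam.colLen j - 1) j =
      shiftedEntry lam mu j k e'.1 (lam.colLen j - 1) j at h1
    have h2 : ∀ e, shiftedEntry lam mu j k e (lam.colLen j - 1) j = e := fun e => by
      rw [shiftedEntry, if_pos (mem_skewCells.2 (by omega)), if_pos ⟨rfl, by omega⟩]
    rw [h2, h2] at h1
    exact Subtype.ext h1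
  omega

theorem mainTheorem3 (lam mu : YoungDiagram) (hsub : mu ≤ lam)
    (m : ℕ) (hm : longestColumn lam mu = m) (n : ℕ) :
    (n < m → restrictVars n (skewSchur lam mu) = 0) ∧
    (m < n → ∀ nu : YoungDiagram,
      (restrictVars n (skewSchur lam mu) = restrictVars n (schur nu) ↔
        skewSchur lam mu = schur nu)) := by
  subst hm
  refine ⟨restrictVars_skewSchur_eq_zero, fun hn nu => ⟨fun h => ?_, fun h => by rw [h]⟩⟩
  have hbase := base_content_eq_of_restrictVars_eq h
    fun x => (colLen_sub_le_longestColumn lam mu x).trans hn.le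
  exact skewSchur_eq_iff.2 ((columnsNested_of_restrictVars_eq hn h).tableauCount_eq hbase)
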